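/- **Distances and lengths.** A distance function on a set is a finite real-valued metric on it. For a distance function $d$ on $\Omega$ and a $d$-Lipschitz curve $c:[a,b]\to\Omega$, let $l_d(c)=\sup\sum_i d(c(t_i),c(t_{i+1}))$, the supremum being over all finite increasing sequences $t_0\le\dots\le t_N$ in $[a,b]$. $d$ is a *length distance* if any two points $x,y$ are joined by $d$-Lipschitz curves and $d(x,y)=\inf l_d(c)$ over all $d$-Lipschitz curves $c:[a,b]\to\Omega$ (any $a\le b$) with $c(a)=x$, $c(b)=y$. **Strong dilatation structures.** Let $(\Omega,\bar d)$ be a complete metric space in which all closed balls of radius $3$ are compact. A *dilatation structure* $(\Omega,\bar d,\bar\delta)$ assigns to each $x\in\Omega$ and $\varepsilon>0$ a homeomorphism $\bar\delta^x_\varepsilon$, from $U(x)$ onto $V_\varepsilon(x)$ if $\varepsilon\le1$ and from $W_\varepsilon(x)$ onto $U(x)$ if $\varepsilon>1$, such that: * (A0) $U(x),V_\varepsilon(x),W_\varepsilon(x)$ are open neighbourhoods of $x$, and there are numbers $1<A<B$ such that, for all $x$ and $\varepsilon\in(0,1)$, $\bar B(x,A)\subset U(x)$ and $B(x,\varepsilon)\subset\bar\delta^x_\varepsilon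 B(x,A)\subset V_\varepsilon(x)\subset W_{\varepsilon^{-1}}(x)\subset\bar\delta^x_\varepsilon(B(x,B)\cap U(x))$. For every compact $K$ there are $R>0$, $\varepsilon_0\in(0,1)$ such that for $x\in K$ we have $\bar B(x,R)\subset U(x)$, and $\bar\delta^x_\varepsilon v\in W_{\varepsilon^{-1}}(\bar\delta^x_\varepsilon u)$ for $u,v\in\bar B(x,R)$, $\varepsilon\in(0,\varepsilon_0)$. * (A1) $\bar\delta^x_\varepsilon x=x$ and $\bar\delta^x_1=\mathrm{id}$; the map $(\varepsilon,x,y)\mapsto\bar\delta^x_\varepsilon y$, on the set of all $(\varepsilon,x,y)$ with $\varepsilon>0$ and $y$ in the domain of $\bar\delta^x_\varepsilon$, extends continuously to the closure of that set in $[0,\infty)\times\Omega\times\Omega$; and $\lim_{\varepsilon\to0}\bar\delta^x_\varepsilon y=x$ for $y\in U(x)$. * (A2) For $\varepsilon,\mu>0$ and $u\in U(x)$ in the domain of $\bar\delta^x_\mu$: $\bar\delta^x_\varepsilon\bar\delta^x_\mu u$ is defined if and only if $\bar\delta^x_{\varepsilon\mu}u$ is, and then they are equal. * (A3) For each $x$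 there is a distance function $\bar d^x$ on $\bar B(x,A)$ with $\sup_{u,v\in\bar B(x,A)}\big|\tfrac1\varepsilon\bar d(\bar\delta^x_\varepsilon u,\bar\delta^x_\varepsilon v)-\bar d^x(u,v)\big|\to0$ as $\varepsilon\to0$, uniformly for $x$ in compact sets. It is *strong* if moreover (A4): $\Delta^x_\varepsilon(u,v)=\bar\delta^{\bar\delta^x_\varepsilon u}_{\varepsilon^{-1}}\bar\delta^x_\varepsilon v$ converges as $\varepsilon\to0$ to some $\Delta^x(u,v)$, in the sense that for every compact $K$ there is $R>0$ such that for $x\in K$, $u,v\in\bar B(x,R)\subset U(x)$ and all small $\varepsilon$ (independently of $x,u,v$) $\Delta^x_\varepsilon(u,v)$ is defined, and the convergence is uniform in these $x,u,v$. **Radon–Nikodym property.** Write $\Sigma^x(u,v)=\lim_{\varepsilon\to0}\bar\delta^x_{\varepsilon^{-1}}\bar\delta^{\bar\delta^x_\varepsilon u}_\varepsilon v$. A curve $c$ is *derivable* at $t$ if, with $x=c(t)$, there are $r>0$ and $f:(-r,r)\to U(x)$ such that $\Sigma^x(f(a),f(b))$ exists and equals $f(a+b)$ whenever $|a|,|b|,|a+b|<r$,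 $f(\mu a)=\bar\delta^x_\mu f(a)$ for $\mu\in(0,1]$, and $\lim_{\varepsilon\to0^+}\frac1\varepsilon\bar d\big(c(t+\varepsilon a),\bar\delta^x_\varepsilon f(a)\big)=0$ for each $|a|<r$. The structure has the *Radon–Nikodym property* if every $\bar d$-Lipschitz curve $c:[a,b]\to\Omega$ is derivable at almost every $t\in(a,b)$. **Tempered structures.** $\mathcal D(\Omega,\bar d,\bar\delta)$ is the set of all distance functions $d$ on $\Omega$ that are length distances and for which there are constants $0<c<C$ such that for every compact $K\subset\Omega$ there is $\rho>0$ with $$c\,\bar d^x(u,v)\le\tfrac1\varepsilon d(\bar\delta^x_\varepsilon u,\bar\delta^x_\varepsilon v)\le C\,\bar d^x(u,v)$$ for all $\varepsilon\in(0,1]$ and all $x,u,v\in K$ whose mutual $\bar d$-distances are at most $\rho$. The structure is *tempered* if $\bar d\in\mathcal D(\Omega,\bar d,\bar\delta)$. **Theorem 8.3.** Let $(\Omega,\bar d,\bar\delta)$ be a tempered strong dilatation structure with the Radon–Nikodym property, and let $d_n,d\in\mathcal D(\Omega,\bar d,\bar\delta)$ be such that $d_n\to d$ uniformly on compact subsets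 of $\Omega\times\Omega$. Let $L_n=l_{d_n}$, defined on the set $Z_n$ of $d_n$-Lipschitz curves in $C([0,1],\Omega)$, and $L=l_d$, defined on the set $Z_0$ of $d$-Lipschitz curves in $C([0,1],\Omega)$, where $C([0,1],\Omega)$ is the space of $\bar d$-continuous curves with the topology of $\bar d$-uniform convergence. Then $L_n$ Gamma-converges to $L$: * (a) if $c_n\in Z_n$ converge in $C([0,1],\Omega)$ to $c\in Z_0$, then $L(c)\le\liminf_{n\to\infty}L_n(c_n)$; * (b) for every $c\in Z_0$ there are $c_n\in Z_n$ converging to $c$ in $C([0,1],\Omega)$ with $\lim_{n\to\infty}L_n(c_n)=L(c)$. -/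

import Mathlib

open Set Filter Topology
open scoped ENNReal

/-- `d` is a (real-valued) distance function on the set `S`; nonnegativity follows from the
axioms. -/
structure IsDistanceOn {X : Type*} (d : X → X → ℝ) (S : Set X) : Prop where
  self : ∀ u ∈ S, d u u = 0
  symm : ∀ u ∈ S, ∀ v ∈ S, d u v = d v u
  triangle : ∀ u ∈ S, ∀ v ∈ S, ∀ w ∈ S, d u w ≤ d u v + d v w
  eq_of_zero : ∀ u ∈ S, ∀ v ∈ S, d u v = 0 → u = v

/-- `c`, restricted to the parameter set `s`, is Lipschitz with respect to the distance `d`. -/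
def IsLipschitzCurveOn {X α : Type*} [PseudoMetricSpace α] (d : X → X → ℝ) (c : α → X)
    (s : Set α) : Prop :=
  ∃ K : ℝ, ∀ p ∈ s, ∀ q ∈ s, d (c p) (c q) ≤ K * dist p q

/-- The length (total variation) of `c` on the parameter set `s`, with respect to `d`. -/
noncomputable def lengthOn {X α : Type*} [LinearOrder α] (d : X → X → ℝ) (c : α → X)
    (s : Set α) : ℝ≥0∞ :=
  ⨆ p : ℕ × { t : ℕ → α // Monotone t ∧ ∀ i, t i ∈ s },
    ∑ i ∈ Finset.range p.1, ENNReal.ofReal (d (c (p.2.1 i)) (c (p.2.1 (i + 1))))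

/-- `d` is a length distance: any two points are joined by `d`-Lipschitz curves, and their
distance is the infimum of the `d`-lengths of these curves.  (If there were no such curve, the
infimum would be `∞`.) -/
def IsLengthDistance {X : Type*} (d : X → X → ℝ) : Prop :=
  ∀ x y : X, ENNReal.ofReal (d x y) =
    sInf { ℓ : ℝ≥0∞ | ∃ (a b : ℝ) (c : ℝ → X), a ≤ b ∧ IsLipschitzCurveOn d c (Icc a b) ∧
      c a = x ∧ c b = y ∧ ℓ = lengthOn d c (Icc a b) }

/-- Gamma-convergence of a sequence of functionals `F n`, with domain `Z n ⊆ Y`, to the functional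
`F₀`, with domain `Z₀ ⊆ Y`. -/
def GammaConverges {Y : Type*} [TopologicalSpace Y] (Z : ℕ → Set Y) (F : ℕ → Y → ℝ≥0∞)
    (Z₀ : Set Y) (F₀ : Y → ℝ≥0∞) : Prop :=
  (∀ y₀ ∈ Z₀, ∀ y : ℕ → Y, (∀ n, y n ∈ Z n) → Tendsto y atTop (𝓝 y₀) →
    F₀ y₀ ≤ liminf (fun n => F n (y n)) atTop) ∧
  (∀ y₀ ∈ Z₀, ∃ y : ℕ → Y, (∀ n, y n ∈ Z n) ∧ Tendsto y atTop (𝓝 y₀) ∧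
    Tendsto (fun n => F n (y n)) atTop (𝓝 (F₀ y₀)))

/-- A dilatation structure over the metric space `X`.  The dilatation of coefficient `ε > 0` based
at `x` is `δ ε x`, a homeomorphism between two open subsets of `X`; only coefficients `ε > 0` are
meaningful.  The numbers `A < B`, and the distances `tdist x` (on the closed ball of radius `A`
around `x`), are those whose existence the axioms assert. -/
structure DilatationStructure (X : Type*) [MetricSpace X] where
  δ : ℝ → X → OpenPartialHomeomorph X X
  U : X → Set X
  V : ℝ → X → Set X
  W : ℝ → X → Set X
  A : ℝ
  B : ℝ
  tdist : X → X → X → ℝ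
  complete : CompleteSpace X
  compact_closedBall : ∀ x : X, IsCompact (Metric.closedBall x 3)
  -- domains and images of the dilatations
  source_le : ∀ x ε, 0 < ε → ε ≤ 1 → (δ ε x).source = U x
  target_le : ∀ x ε, 0 < ε → ε ≤ 1 → (δ ε x).target = V ε x
  source_gt : ∀ x ε, 1 < ε → (δ ε x).source = W ε x
  target_gt : ∀ x ε, 1 < ε → (δ ε x).target = U x
  -- size of the domains
  U_nhds : ∀ x, IsOpen (U x) ∧ x ∈ U x
  V_nhds : ∀ x ε, 0 < ε → ε ≤ 1 → IsOpen (V ε x) ∧ x ∈ V ε x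
  W_nhds : ∀ x ε, 1 < ε → IsOpen (W ε x) ∧ x ∈ W ε x
  one_lt_A : 1 < A
  A_lt_B : A < B
  closedBall_subset_U : ∀ x, Metric.closedBall x A ⊆ U x
  ball_subset : ∀ x ε, 0 < ε → ε < 1 → Metric.ball x ε ⊆ δ ε x '' Metric.ball x A
  image_subset_V : ∀ x ε, 0 < ε → ε < 1 → δ ε x '' Metric.ball x A ⊆ V ε x
  V_subset_W : ∀ x ε, 0 < ε → ε < 1 → V ε x ⊆ W ε⁻¹ x
  W_subset : ∀ x ε, 0 < ε → ε < 1 → W ε⁻¹ x ⊆ δ ε x '' (Metric.ball x B ∩ U x)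
  mem_W : ∀ K : Set X, IsCompact K → ∃ R > 0, ∃ ε₀ ∈ Ioo (0 : ℝ) 1, ∀ x ∈ K,
    Metric.closedBall x R ⊆ U x ∧
    ∀ u ∈ Metric.closedBall x R, ∀ v ∈ Metric.closedBall x R, ∀ ε, 0 < ε → ε < ε₀ →
      δ ε x v ∈ W ε⁻¹ (δ ε x u)
  -- base points and continuity
  map_base : ∀ x ε, 0 < ε → δ ε x x = x
  map_one : ∀ x, ∀ u ∈ U x, δ 1 x u = u
  continuous_extension : ∃ F : ℝ × X × X → X,
    ContinuousOn F (closure {p : ℝ × X × X | 0 < p.1 ∧ p.2.2 ∈ (δ p.1 p.2.1).source}) ∧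
    ∀ ε x y, 0 < ε → y ∈ (δ ε x).source → F (ε, x, y) = δ ε x y
  tendsto_base : ∀ x, ∀ y ∈ U x, Tendsto (fun ε => δ ε x y) (𝓝[>] 0) (𝓝 x)
  -- composition at one base point: once `δ μ x u` makes sense, either side makes sense as soon as the other one does
  comp : ∀ x ε μ, 0 < ε → 0 < μ → ∀ u ∈ U x, u ∈ (δ μ x).source →
    (δ μ x u ∈ (δ ε x).source ↔ u ∈ (δ (ε * μ) x).source) ∧
    (δ μ x u ∈ (δ ε x).source → δ ε x (δ μ x u) = δ (ε * μ) x u)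
  -- metric tangent spaces
  tdist_isDistance : ∀ x, IsDistanceOn (tdist x) (Metric.closedBall x A)
  tdist_limit : ∀ K : Set X, IsCompact K → ∀ η > 0, ∃ ε₀ > 0, ∀ ε, 0 < ε → ε < ε₀ → ε ≤ 1 →
    ∀ x ∈ K, ∀ u ∈ Metric.closedBall x A, ∀ v ∈ Metric.closedBall x A,
      |dist (δ ε x u) (δ ε x v) / ε - tdist x u v| ≤ η

namespace DilatationStructure

variable {X : Type*} [MetricSpace X]

/-- The structure is strong: the approximate differences
`δ ε⁻¹ (δ ε x u) (δ ε x v)` converge as `ε → 0`, uniformly for `x` in a compact set and `u`, `v`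
close enough to `x` for them to be defined. -/
def IsStrong (S : DilatationStructure X) : Prop :=
  ∃ Δ : X → X → X → X, ∀ K : Set X, IsCompact K → ∃ R > 0,
    (∀ x ∈ K, Metric.closedBall x R ⊆ S.U x) ∧
    ∀ η > 0, ∃ ε₀ ∈ Ioo (0 : ℝ) 1, ∀ ε, 0 < ε → ε < ε₀ → ∀ x ∈ K,
      ∀ u ∈ Metric.closedBall x R, ∀ v ∈ Metric.closedBall x R,
        S.δ ε x v ∈ S.W ε⁻¹ (S.δ ε x u) ∧
        dist (S.δ ε⁻¹ (S.δ ε x u) (S.δ ε x v)) (Δ x u v) ≤ η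

/-- `w` is the sum of `u` and `v` in the tangent (local conical) group at `x`: the limit, as
`ε → 0`, of the approximate sums `δ ε⁻¹ x (δ ε (δ ε x u) v)`. -/
def IsTangentSum (S : DilatationStructure X) (x u v w : X) : Prop :=
  u ∈ S.U x ∧
  (∀ᶠ ε in 𝓝[>] (0 : ℝ), v ∈ S.U (S.δ ε x u) ∧ S.δ ε (S.δ ε x u) v ∈ S.W ε⁻¹ x) ∧
  Tendsto (fun ε : ℝ => S.δ ε⁻¹ x (S.δ ε (S.δ ε x u) v)) (𝓝[>] 0) (𝓝 w)

/-- The curve `c` is derivable at `t`: there is a morphism `f` of conical groups, defined near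
`0 ∈ ℝ`, with values in the tangent space at `c t`, that approximates `c` near `t` to first order
in the sense of dilatations. -/
def DerivableAt (S : DilatationStructure X) (c : ℝ → X) (t : ℝ) : Prop :=
  ∃ r > 0, ∃ f : ℝ → X,
    (∀ a, |a| < r → f a ∈ S.U (c t)) ∧
    (∀ a b, |a| < r → |b| < r → |a + b| < r → S.IsTangentSum (c t) (f a) (f b) (f (a + b))) ∧
    (∀ a μ, |a| < r → 0 < μ → μ ≤ 1 → f (μ * a) = S.δ μ (c t) (f a)) ∧
    ∀ a, |a| < r →
      Tendsto (fun ε : ℝ => dist (c (t + ε * a)) (S.δ ε (c t) (f a)) / ε) (𝓝[>] 0) (𝓝 0)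

/-- The Radon-Nikodym property: Lipschitz curves are derivable almost everywhere. -/
def RadonNikodym (S : DilatationStructure X) : Prop :=
  ∀ (a b : ℝ) (c : ℝ → X), IsLipschitzCurveOn (fun u v => dist u v) c (Icc a b) →
    ∀ᵐ t ∂(MeasureTheory.volume.restrict (Ioo a b)), S.DerivableAt c t

/-- The class of length distances `d` on `X` for which there are constants `0 < c < C` with
`c * tdist x u v ≤ d (δ ε x u) (δ ε x v) / ε ≤ C * tdist x u v` for all `ε ∈ (0, 1]` and all
sufficiently close `x`, `u`, `v`. -/
def distanceClass (S : DilatationStructure X) : Set (X → X → ℝ) :=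
  { d | IsDistanceOn d univ ∧ IsLengthDistance d ∧
    ∃ c C : ℝ, 0 < c ∧ c < C ∧ ∀ K : Set X, IsCompact K → ∃ ρ > 0, ∀ ε, 0 < ε → ε ≤ 1 →
      ∀ x ∈ K, ∀ u ∈ K, ∀ v ∈ K, dist x u ≤ ρ → dist x v ≤ ρ → dist u v ≤ ρ →
        c * S.tdist x u v ≤ d (S.δ ε x u) (S.δ ε x v) / ε ∧
        d (S.δ ε x u) (S.δ ε x v) / ε ≤ C * S.tdist x u v }

/-- The structure is tempered if the distance of `X` belongs to the class above. -/
def IsTempered (S : DilatationStructure X) : Prop :=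
  (fun u v : X => dist u v) ∈ S.distanceClass

end DilatationStructure

/-! Lower bound: for one fixed partition, the `dn`-sums along converging curves tend to the `d`-sum
of the limit (`tendsto_distance`); the supremum over partitions gives `lengthOn_le_liminf`. Recovery
curves: cut `c` finely and join consecutive vertices by almost minimal `dn`-curves. The sum of their
lengths is at most the `d`-length of an inscribed polygon plus a small error, hence at most `L(c) +
ε`. Each piece stays close to its initial vertex: on a compact neighbourhood of `c`, points of a
small sphere around a vertex are uniformly far from it for `d`, hence for `dn`, and a piece too
short to reach the sphere cannot cross it (`dist_le_of_length_lt`). A diagonal choice lets `ε` tend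
to `0`. The crossing argument needs the pieces to be continuous for the ambient distance. A
`dn`-Lipschitz curve might jump, since the two distances are compared only between points already
close. `continuous_of_lipschitz_distance` excludes jumps by Baire category, using that the
comparison constants do not depend on the compact set. -/

/-! ### Distance functions and their lengths. -/

namespace IsDistanceOn

variable {X : Type*} {d : X → X → ℝ}

lemma nonneg (h : IsDistanceOn d univ) (u v : X) : 0 ≤ d u v := by
  have h₁ := h.triangle u trivial v trivial u trivial
  rw [h.self u trivial, h.symm v trivial u trivial] at h₁
  linarith

lemma comm (h : IsDistanceOn d univ) (u v : X) : d u v = d v u :=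
  h.symm u trivial v trivial

lemma dist_self (h : IsDistanceOn d univ) (u : X) : d u u = 0 := h.self u trivial

lemma dist_triangle (h : IsDistanceOn d univ) (u v w : X) : d u w ≤ d u v + d v w :=
  h.triangle u trivial v trivial w trivial

/-- A distance function that is bounded by a multiple of the ambient distance near every point is
continuous. -/
lemma continuous_of_locally_le [MetricSpace X] (h : IsDistanceOn d univ)
    (hloc : ∀ x, ∃ ρ > 0, ∃ M : ℝ, ∀ u, dist u x ≤ ρ → d u x ≤ M * dist u x) :
    Continuous fun p : X × X => d p.1 p.2 := by
  have key : ∀ x, Tendsto (fun u => d u x) (𝓝 x) (𝓝 0) := by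
    intro x
    obtain ⟨ρ, hρ, M, hM⟩ := hloc x
    have hlim : Tendsto (fun u => M * dist u x) (𝓝 x) (𝓝 0) := by
      have : Continuous fun u => M * dist u x := by fun_prop
      simpa using this.tendsto x
    refine squeeze_zero' (Eventually.of_forall fun u => h.nonneg u x) ?_ hlim
    filter_upwards [Metric.closedBall_mem_nhds x hρ] with u hu using hM u hu
  rw [continuous_iff_continuousAt]
  rintro ⟨x, y⟩
  rw [ContinuousAt, tendsto_iff_dist_tendsto_zero]
  have hx : Tendsto (fun p : X × X => d p.1 x) (𝓝 (x, y)) (𝓝 0) :=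
    (key x).comp continuous_fst.continuousAt
  have hy : Tendsto (fun p : X × X => d p.2 y) (𝓝 (x, y)) (𝓝 0) :=
    (key y).comp continuous_snd.continuousAt
  refine squeeze_zero (fun _ => dist_nonneg) (fun p => ?_) (by simpa using hx.add hy)
  -- `|d p.1 p.2 - d x y| ≤ d p.1 x + d p.2 y`, by triangle inequalities in both directions.
  rw [Real.dist_eq, abs_le]
  have h₁ := h.dist_triangle p.1 x p.2
  have h₂ := h.dist_triangle x y p.2
  have h₃ := h.dist_triangle x p.1 y
  have h₄ := h.dist_triangle p.1 p.2 y
  have h₅ := h.comm x p.1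
  have h₆ := h.comm y p.2
  constructor <;> linarith

/-- The metric space structure given by a distance function. -/
abbrev toMetricSpace (h : IsDistanceOn d univ) : MetricSpace X where
  dist := d
  dist_self := h.dist_self
  dist_comm := h.comm
  dist_triangle := h.dist_triangle
  eq_of_dist_eq_zero := h.eq_of_zero _ trivial _ trivial

/-- Makes the theory of `eVariationOn` available, notably additivity over adjacent intervals. -/
lemma lengthOn_eq_eVariationOn {α : Type*} [LinearOrder α] (h : IsDistanceOn d univ) (c : α → X)
    (s : Set α) :
    lengthOn d c s = @eVariationOn α _ X h.toMetricSpace.toPseudoEMetricSpace c s := by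
  let := h.toMetricSpace
  refine iSup_congr fun p => Finset.sum_congr rfl fun i _ => ?_
  rw [edist_dist, h.comm]
  rfl

lemma lengthOn_Icc_add_Icc {α : Type*} [LinearOrder α] (h : IsDistanceOn d univ) (c : α → X)
    {p q r : α} (hpq : p ≤ q) (hqr : q ≤ r) :
    lengthOn d c (Icc p r) = lengthOn d c (Icc p q) + lengthOn d c (Icc q r) := by
  let := h.toMetricSpace
  simp only [h.lengthOn_eq_eVariationOn]
  simpa using (eVariationOn.Icc_add_Icc c hpq hqr (mem_univ q)).symm

lemma ofReal_le_lengthOn {α : Type*} [LinearOrder α] (h : IsDistanceOn d univ) (c : α → X)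
    {s : Set α} {p q : α} (hp : p ∈ s) (hq : q ∈ s) :
    ENNReal.ofReal (d (c p) (c q)) ≤ lengthOn d c s := by
  let := h.toMetricSpace
  rw [h.lengthOn_eq_eVariationOn]
  refine le_trans (le_of_eq ?_) (eVariationOn.edist_le c hp hq)
  rw [edist_dist]
  rfl

lemma lengthOn_const {α : Type*} [LinearOrder α] (h : IsDistanceOn d univ) (x : X) (s : Set α) :
    lengthOn d (fun _ => x) s = 0 := by
  simp [lengthOn, h.dist_self]

end IsDistanceOn

/-! ### Reparametrization and concatenation of Lipschitz curves. -/

section Curves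

variable {X : Type*} {d : X → X → ℝ}

lemma lengthOn_congr {α : Type*} [LinearOrder α] {c c' : α → X} {s : Set α} (h : EqOn c c' s) :
    lengthOn d c s = lengthOn d c' s := by
  refine iSup_congr fun p => Finset.sum_congr rfl fun i _ => ?_
  rw [h (p.2.2.2 _), h (p.2.2.2 _)]

lemma lengthOn_comp_le {α β : Type*} [LinearOrder α] [LinearOrder β] (c : α → X) {φ : β → α}
    (hφ : Monotone φ) {s : Set α} {t : Set β} (hst : MapsTo φ t s) :
    lengthOn d (c ∘ φ) t ≤ lengthOn d c s :=
  iSup_le fun p => le_iSup_of_le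
    (⟨p.1, ⟨fun i => φ (p.2.1 i), hφ.comp p.2.2.1, fun i => hst (p.2.2.2 i)⟩⟩ :
      ℕ × { t : ℕ → α // Monotone t ∧ ∀ i, t i ∈ s }) le_rfl

lemma sum_le_lengthOn {α : Type*} [LinearOrder α] (c : α → X) {s : Set α} {t : ℕ → α}
    (ht : Monotone t) (hts : ∀ i, t i ∈ s) (k : ℕ) :
    ∑ i ∈ Finset.range k, ENNReal.ofReal (d (c (t i)) (c (t (i + 1)))) ≤ lengthOn d c s :=
  le_iSup_of_le (⟨k, ⟨t, ht, hts⟩⟩ : ℕ × { t : ℕ → α // Monotone t ∧ ∀ i, t i ∈ s }) le_rfl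

lemma IsLipschitzCurveOn.congr {α : Type*} [PseudoMetricSpace α] {c c' : α → X} {s : Set α}
    (hc : IsLipschitzCurveOn d c s) (h : EqOn c c' s) : IsLipschitzCurveOn d c' s := by
  obtain ⟨K, hK⟩ := hc
  exact ⟨K, fun p hp q hq => by rw [← h hp, ← h hq]; exact hK p hp q hq⟩

lemma IsLipschitzCurveOn.exists_nonneg {α : Type*} [PseudoMetricSpace α] {c : α → X} {s : Set α}
    (hc : IsLipschitzCurveOn d c s) :
    ∃ K : ℝ, 0 ≤ K ∧ ∀ p ∈ s, ∀ q ∈ s, d (c p) (c q) ≤ K * dist p q := by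
  obtain ⟨K, hK⟩ := hc
  exact ⟨max K 0, le_max_right _ _, fun p hp q hq => (hK p hp q hq).trans
    (mul_le_mul_of_nonneg_right (le_max_left _ _) dist_nonneg)⟩

lemma IsLipschitzCurveOn.comp {α β : Type*} [PseudoMetricSpace α] [PseudoMetricSpace β]
    {c : α → X} {s : Set α} (hc : IsLipschitzCurveOn d c s) {φ : β → α} {t : Set β}
    (hst : MapsTo φ t s) {κ : ℝ} (hφ : ∀ p q, dist (φ p) (φ q) ≤ κ * dist p q) :
    IsLipschitzCurveOn d (c ∘ φ) t := by
  obtain ⟨K, hK0, hK⟩ := hc.exists_nonneg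
  refine ⟨K * κ, fun p hp q hq => (hK _ (hst hp) _ (hst hq)).trans ?_⟩
  rw [mul_assoc]
  exact mul_le_mul_of_nonneg_left (hφ p q) hK0

lemma isLipschitzCurveOn_const {α : Type*} [PseudoMetricSpace α] (h : IsDistanceOn d univ) (x : X)
    (s : Set α) : IsLipschitzCurveOn d (fun _ : α => x) s :=
  ⟨0, fun p _ q _ => by simp [h.dist_self]⟩

lemma IsLipschitzCurveOn.Icc_union {c : ℝ → X} (h : IsDistanceOn d univ) {p q r : ℝ}
    (h₁ : IsLipschitzCurveOn d c (Icc p q)) (h₂ : IsLipschitzCurveOn d c (Icc q r)) :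
    IsLipschitzCurveOn d c (Icc p r) := by
  obtain ⟨K₁, hK₁, H₁⟩ := h₁.exists_nonneg
  obtain ⟨K₂, hK₂, H₂⟩ := h₂.exists_nonneg
  have key : ∀ s ∈ Icc p r, ∀ t ∈ Icc p r, s ≤ t → d (c s) (c t) ≤ (K₁ + K₂) * dist s t := by
    intro s hs t ht hst
    rcases le_total t q with htq | hqt
    · refine (H₁ s ⟨hs.1, hst.trans htq⟩ t ⟨ht.1, htq⟩).trans ?_
      exact mul_le_mul_of_nonneg_right (by linarith) dist_nonneg
    rcases le_total q s with hqs | hsq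
    · refine (H₂ s ⟨hqs, hs.2⟩ t ⟨hqt, ht.2⟩).trans ?_
      exact mul_le_mul_of_nonneg_right (by linarith) dist_nonneg
    have e₁ := H₁ s ⟨hs.1, hsq⟩ q ⟨hs.1.trans hsq, le_rfl⟩
    have e₂ := H₂ q ⟨le_rfl, hqt.trans ht.2⟩ t ⟨hqt, ht.2⟩
    have e₃ := h.dist_triangle (c s) (c q) (c t)
    rw [dist_comm, Real.dist_eq, abs_of_nonneg (by linarith)] at e₁ e₂ ⊢
    nlinarith
  refine ⟨K₁ + K₂, fun s hs t ht => ?_⟩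
  rcases le_total s t with hst | hts
  · exact key s hs t ht hst
  · rw [h.comm, dist_comm]
    exact key t ht s hs hts

/-- In a length distance, two points are the endpoints of a Lipschitz curve, parametrized on a given
interval, whose length exceeds their distance by as little as one wishes. -/
lemma IsLengthDistance.exists_curve (hd : IsDistanceOn d univ) (hl : IsLengthDistance d) (x y : X)
    {η : ℝ} (hη : 0 < η) {a b : ℝ} (hab : a < b) :
    ∃ c : ℝ → X, IsLipschitzCurveOn d c (Icc a b) ∧ c a = x ∧ c b = y ∧
      lengthOn d c (Icc a b) ≤ ENNReal.ofReal (d x y + η) := by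
  have hlt : sInf { ℓ : ℝ≥0∞ | ∃ (a b : ℝ) (c : ℝ → X), a ≤ b ∧ IsLipschitzCurveOn d c (Icc a b) ∧
      c a = x ∧ c b = y ∧ ℓ = lengthOn d c (Icc a b) } < ENNReal.ofReal (d x y + η) := by
    rw [← hl x y]
    exact (ENNReal.ofReal_lt_ofReal_iff (by linarith [hd.nonneg x y])).2 (by linarith)
  obtain ⟨_, ⟨p, q, c, hpq, hc, rfl, rfl, rfl⟩, hlen⟩ := sInf_lt_iff.1 hlt
  -- Slope of the affine map from `[a, b]` onto `[p, q]`; it vanishes if `p = q`, which is harmless.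
  set κ := (q - p) / (b - a) with hκ
  have hκ0 : 0 ≤ κ := div_nonneg (by linarith) (by linarith)
  have hκm : κ * (b - a) = q - p := div_mul_cancel₀ _ (by linarith)
  have hmono : Monotone fun t : ℝ => p + κ * (t - a) := by
    intro s t hst
    have := mul_le_mul_of_nonneg_left (sub_le_sub_right hst a) hκ0
    dsimp only
    linarith
  have hmaps : MapsTo (fun t : ℝ => p + κ * (t - a)) (Icc a b) (Icc p q) := by
    intro t ht
    have h₁ := hmono ht.1
    have h₂ := hmono ht.2
    simp only [sub_self, mul_zero, add_zero, hκm] at h₁ h₂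
    exact ⟨h₁, by linarith⟩
  refine ⟨c ∘ fun t => p + κ * (t - a), hc.comp hmaps (κ := κ) fun s t => le_of_eq ?_, ?_, ?_,
    (lengthOn_comp_le c hmono hmaps).trans hlen.le⟩
  · rw [Real.dist_eq, Real.dist_eq, ← abs_of_nonneg hκ0, ← abs_mul, abs_of_nonneg hκ0]
    congr 1
    ring
  · simp
  · simp [hκm]

/-- Consecutive curves can be concatenated. -/
lemma exists_concatenation (hd : IsDistanceOn d univ) (τ : ℕ → ℝ) (hτ : StrictMono τ) (p : ℕ → X)
    (γ : ℕ → ℝ → X) (hγ : ∀ i, IsLipschitzCurveOn d (γ i) (Icc (τ i) (τ (i + 1))))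
    (hl : ∀ i, γ i (τ i) = p i) (hr : ∀ i, γ i (τ (i + 1)) = p (i + 1)) (k : ℕ) :
    ∃ g : ℝ → X, IsLipschitzCurveOn d g (Icc (τ 0) (τ k)) ∧ g (τ k) = p k ∧
      lengthOn d g (Icc (τ 0) (τ k)) =
        ∑ i ∈ Finset.range k, lengthOn d (γ i) (Icc (τ i) (τ (i + 1))) ∧
      ∀ t ∈ Icc (τ 0) (τ k), t < τ k → ∃ i < k, t ∈ Icc (τ i) (τ (i + 1)) ∧ g t = γ i t := by
  induction k with
  | zero =>
    refine ⟨fun _ => p 0, isLipschitzCurveOn_const hd _ _, rfl, by simp [hd.lengthOn_const], ?_⟩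
    -- With no pieces the interval is a single point lying on no piece, hence the restriction to `t
    -- < τ k`.
    intro t ht htk
    exact absurd ht.1 (not_le.2 htk)
  | succ k ih =>
    obtain ⟨g, hg, hgk, hlen, hmem⟩ := ih
    have hlt : τ k < τ (k + 1) := hτ k.lt_succ_self
    have h0k : τ 0 ≤ τ k := hτ.monotone k.zero_le
    set G : ℝ → X := fun t => if t < τ k then g t else γ k t with hG
    have e₁ : EqOn g G (Icc (τ 0) (τ k)) := by
      intro t ht
      rcases ht.2.lt_or_eq with h | rfl
      · simp [hG, h]
      · simp [hG, hgk, hl]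
    have e₂ : EqOn (γ k) G (Icc (τ k) (τ (k + 1))) := by
      intro t ht
      simp [hG, not_lt.2 ht.1]
    refine ⟨G, (hg.congr e₁).Icc_union hd ((hγ k).congr e₂), ?_, ?_, ?_⟩
    · rw [← e₂ ⟨hlt.le, le_rfl⟩, hr]
    · rw [hd.lengthOn_Icc_add_Icc G h0k hlt.le, ← lengthOn_congr e₁, ← lengthOn_congr e₂, hlen,
        Finset.sum_range_succ]
    · intro t ht htk
      rcases lt_or_ge t (τ k) with h | h
      · obtain ⟨i, hi, hti, hgt⟩ := hmem t ⟨ht.1, h.le⟩ h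
        exact ⟨i, hi.trans k.lt_succ_self, hti, by rw [← hgt, e₁ ⟨ht.1, h.le⟩]⟩
      · exact ⟨k, k.lt_succ_self, ⟨h, htk.le⟩, (e₂ ⟨h, htk.le⟩).symm⟩

end Curves

/-! ### Continuity of curves that are Lipschitz for another distance. -/

section Regularity

variable {X : Type*} [MetricSpace X] {d : X → X → ℝ}

/-- Continuous induction: the set of `x` where the bound from `s` to `x` holds is closed, and the
local bound extends it to the right. -/
lemma dist_le_of_locally_dist_le {γ : ℝ → X} {M s t : ℝ} (hst : s ≤ t)
    (h : ∀ x ∈ Icc s t, ∃ ε > 0, ∀ u v, |u - x| < ε → |v - x| < ε →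
      dist (γ u) (γ v) ≤ M * |u - v|) :
    dist (γ s) (γ t) ≤ M * (t - s) := by
  have hcont : ContinuousOn γ (Icc s t) := by
    intro x hx
    obtain ⟨ε, hε, H⟩ := h x hx
    refine ContinuousAt.continuousWithinAt ?_
    rw [ContinuousAt, tendsto_iff_dist_tendsto_zero]
    have hlim : Tendsto (fun u => M * |u - x|) (𝓝 x) (𝓝 0) := by
      have : Continuous fun u => M * |u - x| := by fun_prop
      simpa using this.tendsto x
    refine squeeze_zero' (Eventually.of_forall fun _ => dist_nonneg) ?_ hlim
    filter_upwards [Metric.ball_mem_nhds x hε] with u hu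
    exact H u x hu (by simpa using hε)
  have hclosed : IsClosed ({x | dist (γ s) (γ x) ≤ M * (x - s)} ∩ Icc s t) := by
    have := isClosed_Icc.isClosed_le (continuous_dist.comp_continuousOn (continuousOn_const.prodMk hcont))
      (by fun_prop : ContinuousOn (fun x => M * (x - s)) (Icc s t))
      (f := fun x => dist (γ s) (γ x))
    convert this using 1
    ext x
    simp [and_comm]
  refine hclosed.Icc_subset_of_forall_exists_gt (by simp) ?_ ⟨hst, le_rfl⟩
  intro x hx y hy
  obtain ⟨ε, hε, H⟩ := h x (Ico_subset_Icc_self hx.2)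
  have hw : x < min y (x + ε / 2) := lt_min hy (by linarith)
  refine ⟨min y (x + ε / 2), ?_, hw, min_le_left _ _⟩
  have h₁ := H x (min y (x + ε / 2)) (by simpa using hε) (by
    rw [abs_of_pos (by linarith)]
    linarith [min_le_right y (x + ε / 2)])
  rw [abs_sub_comm, abs_of_pos (by linarith)] at h₁
  have h₂ : dist (γ s) (γ x) ≤ M * (x - s) := hx.1
  have h₃ := dist_triangle (γ s) (γ x) (γ (min y (x + ε / 2)))
  change dist (γ s) (γ (min y (x + ε / 2))) ≤ M * (min y (x + ε / 2) - s)
  linarith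

/-- The bound makes `γ` Cauchy along `A`, so it has an ambient limit at each point of the closure.
That limit is at `d`-distance `0` from the value of `γ`, hence equals it, and the bound passes to
the limit. -/
lemma dist_le_of_mem_closure [CompleteSpace X] (hd : IsDistanceOn d univ)
    (hcont : Continuous fun p : X × X => d p.1 p.2) {γ : ℝ → X} {L M : ℝ}
    (hγ : ∀ s t, d (γ s) (γ t) ≤ L * |s - t|) {A : Set ℝ}
    (h : ∀ s ∈ A, ∀ t ∈ A, dist (γ s) (γ t) ≤ M * |s - t|) :
    ∀ s ∈ closure A, ∀ t ∈ closure A, dist (γ s) (γ t) ≤ M * |s - t| := by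
  have key : ∀ p ∈ closure A, Tendsto γ (𝓝[A] p) (𝓝 (γ p)) := by
    intro p hp
    have : (𝓝[A] p).NeBot := mem_closure_iff_nhdsWithin_neBot.1 hp
    have hcauchy : Cauchy (map γ (𝓝[A] p)) := by
      rw [cauchy_map_iff]
      refine ⟨inferInstance, ?_⟩
      rw [tendsto_uniformity_iff_dist_tendsto_zero]
      have hlim : Tendsto (fun q : ℝ × ℝ => M * |q.1 - q.2|) (𝓝[A] p ×ˢ 𝓝[A] p) (𝓝 0) := by
        have : Continuous fun q : ℝ × ℝ => M * |q.1 - q.2| := by fun_prop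
        have h₀ := this.tendsto (p, p)
        rw [nhds_prod_eq] at h₀
        simpa using h₀.mono_left (prod_mono nhdsWithin_le_nhds nhdsWithin_le_nhds)
      refine squeeze_zero' (Eventually.of_forall fun _ => dist_nonneg) ?_ hlim
      filter_upwards [prod_mem_prod self_mem_nhdsWithin self_mem_nhdsWithin] with q hq
      exact h q.1 hq.1 q.2 hq.2
    obtain ⟨z, hz⟩ := cauchy_map_iff_exists_tendsto.1 hcauchy
    have h₁ : Tendsto (fun s => d (γ s) (γ p)) (𝓝[A] p) (𝓝 (d z (γ p))) :=
      (hcont.tendsto (z, γ p)).comp (hz.prodMk_nhds tendsto_const_nhds)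
    have h₂ : Tendsto (fun s => L * |s - p|) (𝓝[A] p) (𝓝 0) := by
      have : Continuous fun s => L * |s - p| := by fun_prop
      simpa using (this.tendsto p).mono_left nhdsWithin_le_nhds
    have h₃ : d z (γ p) ≤ 0 := le_of_tendsto_of_tendsto' h₁ h₂ fun s => hγ s p
    rwa [hd.eq_of_zero z trivial (γ p) trivial (le_antisymm h₃ (hd.nonneg _ _))] at hz
  intro s hs t ht
  have : (𝓝[A] s).NeBot := mem_closure_iff_nhdsWithin_neBot.1 hs
  have : (𝓝[A] t).NeBot := mem_closure_iff_nhdsWithin_neBot.1 ht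
  have h₁ : Tendsto (fun q : ℝ × ℝ => dist (γ q.1) (γ q.2)) (𝓝[A] s ×ˢ 𝓝[A] t)
      (𝓝 (dist (γ s) (γ t))) :=
    ((key s hs).comp tendsto_fst).dist ((key t ht).comp tendsto_snd)
  have h₂ : Tendsto (fun q : ℝ × ℝ => M * |q.1 - q.2|) (𝓝[A] s ×ˢ 𝓝[A] t) (𝓝 (M * |s - t|)) := by
    have : Continuous fun q : ℝ × ℝ => M * |q.1 - q.2| := by fun_prop
    have h₀ := this.tendsto (s, t)
    rw [nhds_prod_eq] at h₀
    exact h₀.mono_left (prod_mono nhdsWithin_le_nhds nhdsWithin_le_nhds)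
  refine le_of_tendsto_of_tendsto h₁ h₂ ?_
  filter_upwards [prod_mem_prod self_mem_nhdsWithin self_mem_nhdsWithin] with q hq
  exact h q.1 hq.1 q.2 hq.2

/-- On a compact set, points that are close for a continuous distance function are close. -/
lemma IsCompact.exists_pos_le_distance (hd : IsDistanceOn d univ)
    (hcont : Continuous fun p : X × X => d p.1 p.2) {K : Set X} (hK : IsCompact K) {ρ : ℝ}
    (hρ : 0 < ρ) : ∃ θ > 0, ∀ u ∈ K, ∀ v ∈ K, ρ ≤ dist u v → θ ≤ d u v := by
  have hcomp : IsCompact ((K ×ˢ K) ∩ {p : X × X | ρ ≤ dist p.1 p.2}) :=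
    (hK.prod hK).inter_right (isClosed_le continuous_const continuous_dist)
  rcases ((K ×ˢ K) ∩ {p : X × X | ρ ≤ dist p.1 p.2}).eq_empty_or_nonempty with he | hne
  · refine ⟨1, one_pos, fun u hu v hv h => ?_⟩
    exact absurd (show (u, v) ∈ (K ×ˢ K) ∩ {p : X × X | ρ ≤ dist p.1 p.2} from ⟨⟨hu, hv⟩, h⟩)
      (by simp [he])
  · obtain ⟨p, hp, hmin⟩ := hcomp.exists_isMinOn hne hcont.continuousOn
    refine ⟨d p.1 p.2, (hd.nonneg _ _).lt_of_ne fun h => ?_, fun u hu v hv h =>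
      hmin (show (u, v) ∈ (K ×ˢ K) ∩ {p : X × X | ρ ≤ dist p.1 p.2} from ⟨⟨hu, hv⟩, h⟩)⟩
    have h₀ : p.1 = p.2 := hd.eq_of_zero _ trivial _ trivial h.symm
    have h₁ : ρ ≤ dist p.1 p.2 := hp.2
    rw [h₀, _root_.dist_self] at h₁
    linarith

/-- A curve that is Lipschitz for a distance function `d` bounding the ambient distance locally,
with a constant that does not depend on the place, is Lipschitz: even though `d`-close points need
not be close, the curve has no jumps, by a Baire category argument. -/
lemma continuous_of_lipschitz_distance [CompleteSpace X] (hd : IsDistanceOn d univ)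
    (hcont : Continuous fun p : X × X => d p.1 p.2) {K : ℕ → Set X} (hK : ∀ n, IsCompact (K n))
    (hcover : ⋃ n, K n = univ) {m : ℝ} (hm : 0 ≤ m)
    (hloc : ∀ n, ∃ ρ > 0, ∀ u ∈ K n, ∀ v ∈ K n, dist u v ≤ ρ → dist u v ≤ m * d u v)
    {γ : ℝ → X} {L : ℝ} (hγ : ∀ s t, d (γ s) (γ t) ≤ L * |s - t|) : Continuous γ := by
  set M := m * L with hM
  -- The good parameters, near which `γ` is `M`-Lipschitz for the ambient distance; the aim is `G =
  -- univ`.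
  set G : Set ℝ := {x | ∃ ε > 0, ∀ u v, |u - x| < ε → |v - x| < ε →
    dist (γ u) (γ v) ≤ M * |u - v|} with hG
  have hGopen : IsOpen G := by
    rw [Metric.isOpen_iff]
    rintro x ⟨ε, hε, H⟩
    refine ⟨ε / 2, by linarith, fun y hy => ⟨ε / 2, by linarith, fun u v hu hv => ?_⟩⟩
    rw [Metric.mem_ball, Real.dist_eq] at hy
    have hu' := abs_add_le (u - y) (y - x)
    have hv' := abs_add_le (v - y) (y - x)
    rw [sub_add_sub_cancel] at hu' hv'
    exact H u v (by linarith) (by linarith)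
  have hgap : ∀ p q, p ≤ q → Ioo p q ⊆ G → dist (γ p) (γ q) ≤ M * (q - p) := by
    intro p q hpq hsub
    rcases hpq.eq_or_lt with rfl | hlt
    · simp
    have hIoo : ∀ s ∈ Ioo p q, ∀ t ∈ Ioo p q, dist (γ s) (γ t) ≤ M * |s - t| := by
      have aux : ∀ s ∈ Ioo p q, ∀ t ∈ Ioo p q, s ≤ t → dist (γ s) (γ t) ≤ M * |s - t| := by
        intro s hs t ht hst
        rw [abs_sub_comm, abs_of_nonneg (by linarith)]
        exact dist_le_of_locally_dist_le hst fun x hx =>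
          hsub ⟨hs.1.trans_le hx.1, hx.2.trans_lt ht.2⟩
      intro s hs t ht
      rcases le_total s t with hst | hst
      · exact aux s hs t ht hst
      · rw [dist_comm, abs_sub_comm]
        exact aux t ht s hs hst
    have := dist_le_of_mem_closure hd hcont hγ hIoo p (by simp [closure_Ioo hlt.ne, hpq]) q
      (by simp [closure_Ioo hlt.ne, hpq])
    rwa [abs_sub_comm, abs_of_nonneg (by linarith)] at this
  -- Continuity of `γ` is not yet known; compactness of `K n` supplies an ambient limit, and `d`
  -- identifies it.
  have hpre : ∀ n, IsClosed (γ ⁻¹' K n) := by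
    intro n
    refine IsSeqClosed.isClosed fun t p ht htp => ?_
    obtain ⟨z, hz, φ, hφ, hlim⟩ := (hK n).tendsto_subseq ht
    have h₁ : Tendsto (fun k => d (γ (t (φ k))) (γ p)) atTop (𝓝 (d z (γ p))) :=
      (hcont.tendsto (z, γ p)).comp (hlim.prodMk_nhds tendsto_const_nhds)
    have h₂ : Tendsto (fun k => L * |t (φ k) - p|) atTop (𝓝 0) := by
      have : Continuous fun s => L * |s - p| := by fun_prop
      simpa [Function.comp_def] using (this.tendsto p).comp (htp.comp hφ.tendsto_atTop)
    have h₃ : d z (γ p) ≤ 0 := le_of_tendsto_of_tendsto' h₁ h₂ fun k => hγ _ _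
    rw [mem_preimage, ← hd.eq_of_zero z trivial (γ p) trivial (le_antisymm h₃ (hd.nonneg _ _))]
    exact hz
  have hGuniv : G = univ := by
    by_contra hne
    have hEclosed : IsClosed Gᶜ := hGopen.isClosed_compl
    have : Nonempty (Gᶜ : Set ℝ) := (nonempty_compl.2 hne).to_subtype
    have : CompleteSpace (Gᶜ : Set ℝ) := hEclosed.completeSpace_coe
    -- Baire in the closed set of bad parameters: near some `t₀`, all of them are sent into a single
    -- `K n`.
    obtain ⟨n, ⟨t₀, ht₀G⟩, ht₀⟩ := nonempty_interior_of_iUnion_of_closed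
      (f := fun n => (Subtype.val : (Gᶜ : Set ℝ) → ℝ) ⁻¹' (γ ⁻¹' K n))
      (fun n => (hpre n).preimage continuous_subtype_val) (by
        rw [← preimage_iUnion, ← preimage_iUnion, hcover, preimage_univ, preimage_univ])
    rw [mem_interior_iff_mem_nhds, Metric.mem_nhds_iff] at ht₀
    obtain ⟨η, hη, hball⟩ := ht₀
    have hE : ∀ s, s ∉ G → |s - t₀| < η → γ s ∈ K n := fun s hs hst =>
      hball (show (⟨s, hs⟩ : (Gᶜ : Set ℝ)) ∈ Metric.ball ⟨t₀, ht₀G⟩ η from hst)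
    obtain ⟨ρ, hρ, hρK⟩ := hloc n
    obtain ⟨θ, hθ, hθK⟩ := (hK n).exists_pos_le_distance hd hcont hρ
    obtain ⟨ε, hε, hεη, hεL⟩ : ∃ ε > 0, ε ≤ η ∧ L * (2 * ε) < θ := by
      refine ⟨min η (θ / (4 * (|L| + 1))), lt_min hη (by positivity), min_le_left _ _, ?_⟩
      have h₁ : L ≤ |L| + 1 := by linarith [le_abs_self L]
      have h₂ : min η (θ / (4 * (|L| + 1))) ≤ θ / (4 * (|L| + 1)) := min_le_right _ _
      have h₃ : 0 < min η (θ / (4 * (|L| + 1))) := lt_min hη (by positivity)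
      calc L * (2 * min η (θ / (4 * (|L| + 1))))
          ≤ (|L| + 1) * (2 * (θ / (4 * (|L| + 1)))) := by gcongr
        _ = θ / 2 := by field_simp; norm_num
        _ < θ := by linarith
    have hL : 0 ≤ L := by
      have := (hd.nonneg _ _).trans (hγ 0 1)
      simpa using this
    -- Inside the compact `K n`, `d`-closeness forces ambient closeness, so the local comparison
    -- applies.
    have hbad : ∀ p ∉ G, ∀ q ∉ G, |p - t₀| < ε → |q - t₀| < ε → p ≤ q →
        dist (γ p) (γ q) ≤ M * (q - p) := by
      intro p hp q hq hpε hqε hpq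
      have hpK := hE p hp (hpε.trans_le hεη)
      have hqK := hE q hq (hqε.trans_le hεη)
      have hdist := hγ p q
      rw [abs_sub_comm, abs_of_nonneg (by linarith)] at hdist
      have hlt : d (γ p) (γ q) < θ := by
        refine (hdist.trans (mul_le_mul_of_nonneg_left ?_ hL)).trans_lt hεL
        linarith [(abs_lt.1 hpε).1, (abs_lt.1 hqε).2]
      have hclose : dist (γ p) (γ q) ≤ ρ := by
        by_contra hcon
        exact absurd (hθK _ hpK _ hqK (not_le.1 hcon).le) (not_le.2 hlt)
      calc dist (γ p) (γ q) ≤ m * d (γ p) (γ q) := hρK _ hpK _ hqK hclose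
        _ ≤ m * (L * (q - p)) := mul_le_mul_of_nonneg_left hdist hm
        _ = M * (q - p) := by rw [hM]; ring
    -- Split at the first and last bad parameters `p`, `q` of `[s, t]`: `hgap` handles the two outer
    -- intervals and `hbad` the jump from `p` to `q`. Thus `t₀` would be good.
    have hmain : ∀ s t, |s - t₀| < ε → |t - t₀| < ε → s ≤ t →
        dist (γ s) (γ t) ≤ M * (t - s) := by
      intro s t hs ht hst
      rcases (Gᶜ ∩ Icc s t).eq_empty_or_nonempty with he | hne'
      · refine hgap s t hst fun x hx => ?_
        by_contra hxG
        exact (he ▸ (⟨hxG, hx.1.le, hx.2.le⟩ : x ∈ Gᶜ ∩ Icc s t) : x ∈ (∅ : Set ℝ))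
      have hcl : IsClosed (Gᶜ ∩ Icc s t) := hEclosed.inter isClosed_Icc
      have hbelow : BddBelow (Gᶜ ∩ Icc s t) := bddBelow_Icc.mono inter_subset_right
      have habove : BddAbove (Gᶜ ∩ Icc s t) := bddAbove_Icc.mono inter_subset_right
      have hp := hcl.csInf_mem hne' hbelow
      have hq := hcl.csSup_mem hne' habove
      set p := sInf (Gᶜ ∩ Icc s t)
      set q := sSup (Gᶜ ∩ Icc s t)
      have hpq : p ≤ q := le_csSup habove hp
      have h₁ : dist (γ s) (γ p) ≤ M * (p - s) := by
        refine hgap s p hp.2.1 fun x hx => ?_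
        by_contra hxG
        exact absurd (csInf_le hbelow ⟨hxG, hx.1.le, hx.2.le.trans hp.2.2⟩) (not_le.2 hx.2)
      have h₃ : dist (γ q) (γ t) ≤ M * (t - q) := by
        refine hgap q t hq.2.2 fun x hx => ?_
        by_contra hxG
        exact absurd (le_csSup habove ⟨hxG, hq.2.1.trans hx.1.le, hx.2.le⟩) (not_le.2 hx.1)
      rw [abs_lt] at hs ht
      have h₂ := hbad p hp.1 q hq.1
        (abs_lt.2 ⟨by linarith [hp.2.1], by linarith [hp.2.2]⟩)
        (abs_lt.2 ⟨by linarith [hq.2.1], by linarith [hq.2.2]⟩) hpq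
      linarith [dist_triangle (γ s) (γ p) (γ t), dist_triangle (γ p) (γ q) (γ t)]
    refine ht₀G ⟨ε, hε, fun u v hu hv => ?_⟩
    rcases le_total u v with huv | hvu
    · rw [abs_sub_comm, abs_of_nonneg (by linarith)]
      exact hmain u v hu hv huv
    · rw [dist_comm, abs_of_nonneg (by linarith)]
      exact hmain v u hv hu hvu
  have hlip : ∀ s t, s ≤ t → dist (γ s) (γ t) ≤ M * (t - s) := fun s t hst =>
    hgap s t hst (by simp [hGuniv])
  refine (LipschitzWith.of_dist_le_mul (K := M.toNNReal) fun s t => ?_).continuous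
  refine le_trans ?_ (mul_le_mul_of_nonneg_right (Real.le_coe_toNNReal M) dist_nonneg)
  rcases le_total s t with hst | hts
  · rw [dist_comm s t, Real.dist_eq, abs_of_nonneg (by linarith)]
    exact hlip s t hst
  · rw [dist_comm, Real.dist_eq, abs_of_nonneg (by linarith)]
    exact hlip t s hts

end Regularity

/-! ### Diagonal selection and confinement of short curves. -/

/-- Diagonal argument: `y n` realizes the largest attainable `k ≤ n`, and antitonicity gives all
smaller ones; if none is attainable, any element of `Z n` serves. -/
lemma exists_seq_of_forall_eventually {Y : Type*} {Z : ℕ → Set Y} (hZ : ∀ n, (Z n).Nonempty)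
    {P : ℕ → ℕ → Y → Prop} (hmono : ∀ n y, Antitone fun k => P n k y)
    (h : ∀ k, ∀ᶠ n in atTop, ∃ y ∈ Z n, P n k y) :
    ∃ y : ℕ → Y, (∀ n, y n ∈ Z n) ∧ ∀ k, ∀ᶠ n in atTop, P n k (y n) := by
  classical
  have hex : ∀ n, ∃ y ∈ Z n, ∀ k ≤ n, (∃ y ∈ Z n, P n k y) → P n k y := by
    intro n
    by_cases hn : ∃ k ≤ n, ∃ y ∈ Z n, P n k y
    · obtain ⟨k₀, hk₀, hy₀⟩ := hn
      obtain ⟨y, hy, hPy⟩ := Nat.findGreatest_spec (P := fun k => ∃ y ∈ Z n, P n k y) hk₀ hy₀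
      exact ⟨y, hy, fun k hk hk' => hmono n y (Nat.le_findGreatest hk hk') hPy⟩
    · obtain ⟨y, hy⟩ := hZ n
      exact ⟨y, hy, fun k hk hk' => absurd ⟨k, hk, hk'⟩ hn⟩
  choose y hy hPy using hex
  refine ⟨y, hy, fun k => ?_⟩
  filter_upwards [h k, eventually_ge_atTop k] with n hn hkn using hPy n k hkn hn

/-- A curve whose length is less than the distance from its origin to every point of a sphere
around it does not leave the ball. -/
lemma dist_le_of_length_lt {X : Type*} [MetricSpace X] {d : X → X → ℝ} (hd : IsDistanceOn d univ)
    {γ : ℝ → X} {a b r ℓ : ℝ} (hcont : ContinuousOn γ (Icc a b)) (hr : 0 ≤ r) (hℓ : 0 ≤ ℓ)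
    (hlen : lengthOn d γ (Icc a b) ≤ ENNReal.ofReal ℓ)
    (hfar : ∀ z, dist (γ a) z = r → ℓ < d (γ a) z) :
    ∀ t ∈ Icc a b, dist (γ a) (γ t) ≤ r := by
  intro t ht
  by_contra! hlt
  have hc : ContinuousOn (fun s => dist (γ a) (γ s)) (Icc a t) :=
    continuous_dist.comp_continuousOn
      (continuousOn_const.prodMk (hcont.mono (Icc_subset_Icc_right ht.2)))
  obtain ⟨s, hs, hsr⟩ := intermediate_value_Icc ht.1 hc ⟨by simpa using hr, hlt.le⟩
  have ha : a ∈ Icc a b := ⟨le_rfl, ht.1.trans ht.2⟩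
  have hsb : s ∈ Icc a b := ⟨hs.1, hs.2.trans ht.2⟩
  have h₁ := (hd.ofReal_le_lengthOn γ ha hsb).trans hlen
  exact absurd ((ENNReal.ofReal_le_ofReal_iff hℓ).1 h₁) (not_le.2 (hfar _ hsr))

/-! ### Compactness and local comparison in tempered structures. -/

namespace DilatationStructure

variable {X : Type*} [MetricSpace X] {S : DilatationStructure X} {d : X → X → ℝ}

lemma exists_isCompact_of_dist_le_one (S : DilatationStructure X) {K : Set X} (hK : IsCompact K) :
    ∃ K', IsCompact K' ∧ ∀ x ∈ K, ∀ y, dist x y ≤ 1 → y ∈ K' := by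
  obtain ⟨t, -, htf, htK⟩ := hK.finite_cover_balls one_pos
  refine ⟨⋃ x ∈ t, Metric.closedBall x 3, htf.isCompact_biUnion fun x _ => S.compact_closedBall x,
    fun x hx y hxy => ?_⟩
  obtain ⟨z, hz, hxz⟩ := mem_iUnion₂.1 (htK hx)
  refine mem_iUnion₂.2 ⟨z, hz, ?_⟩
  rw [Metric.mem_closedBall]
  rw [Metric.mem_ball] at hxz
  linarith [dist_triangle y x z, dist_comm x y]

lemma IsTempered.preconnectedSpace (h : S.IsTempered) : PreconnectedSpace X := by
  refine ⟨isPreconnected_of_forall_pair fun x _ y _ => ?_⟩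
  obtain ⟨c, hc, rfl, rfl, -⟩ := h.2.1.exists_curve h.1 x y one_pos (zero_lt_one (α := ℝ))
  obtain ⟨L, hL0, hL⟩ := hc.exists_nonneg
  have hcont : ContinuousOn c (Icc 0 1) :=
    (LipschitzOnWith.of_dist_le_mul (K := ⟨L, hL0⟩) hL).continuousOn
  exact ⟨c '' Icc 0 1, subset_univ _, mem_image_of_mem _ (by simp), mem_image_of_mem _ (by simp),
    isPreconnected_Icc.image _ hcont⟩

/-- Iterated compact unit enlargements of `{x}` have a clopen union, which is everything by
connectedness. This is the countable cover for the Baire argument. -/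
lemma IsTempered.exists_compact_cover (h : S.IsTempered) (x : X) :
    ∃ K : ℕ → Set X, (∀ n, IsCompact (K n)) ∧ ⋃ n, K n = univ := by
  have := h.preconnectedSpace
  choose f hf hfK using fun K : { K : Set X // IsCompact K } =>
    S.exists_isCompact_of_dist_le_one K.2
  let K : ℕ → { K : Set X // IsCompact K } := fun n =>
    Nat.rec ⟨{x}, isCompact_singleton⟩ (fun _ K => ⟨f K, hf K⟩) n
  have hstep : ∀ y ∈ ⋃ n, (K n).1, ∀ z, dist y z ≤ 1 → z ∈ ⋃ n, (K n).1 := by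
    intro y hy z hyz
    obtain ⟨n, hn⟩ := mem_iUnion.1 hy
    exact mem_iUnion.2 ⟨n + 1, hfK (K n) y hn z hyz⟩
  refine ⟨fun n => (K n).1, fun n => (K n).2, IsClopen.eq_univ ⟨?_, ?_⟩ ⟨x, mem_iUnion.2 ⟨0, rfl⟩⟩⟩
  · rw [← isOpen_compl_iff, Metric.isOpen_iff]
    exact fun y hy => ⟨1, one_pos, fun z hz hz' => hy (hstep z hz' y (le_of_lt hz))⟩
  · rw [Metric.isOpen_iff]
    exact fun y hy => ⟨1, one_pos, fun z hz => hstep y hy z (le_of_lt (by rwa [dist_comm]))⟩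

/-- The distances of the class are locally comparable to the ambient distance, with constants
that do not depend on the place. -/
lemma IsTempered.locally_comparable (h : S.IsTempered) (hd : d ∈ S.distanceClass) :
    ∃ m M : ℝ, 0 ≤ m ∧ ∀ K : Set X, IsCompact K → ∃ ρ > 0, ∀ u ∈ K, ∀ v ∈ K, dist u v ≤ ρ →
      dist u v ≤ m * d u v ∧ d u v ≤ M * dist u v := by
  obtain ⟨-, -, c₀, C₀, hc₀, hC₀, H₀⟩ := h
  obtain ⟨-, -, c₁, C₁, hc₁, hC₁, H₁⟩ := hd
  refine ⟨C₀ / c₁, C₁ / c₀, div_nonneg (by linarith) hc₁.le, fun K hK => ?_⟩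
  obtain ⟨ρ₀, hρ₀, P₀⟩ := H₀ K hK
  obtain ⟨ρ₁, hρ₁, P₁⟩ := H₁ K hK
  refine ⟨min 1 (min ρ₀ ρ₁), by positivity, fun u hu v hv huv => ?_⟩
  simp only [le_min_iff] at huv
  -- At `ε = 1` and base point `u` the dilatation is the identity, so both distances are compared
  -- with `S.tdist u u v`.
  have hu₁ : S.δ 1 u u = u := S.map_one u u (S.U_nhds u).2
  have hv₁ : S.δ 1 u v = v := by
    refine S.map_one u v (S.closedBall_subset_U u ?_)
    rw [Metric.mem_closedBall, dist_comm]
    exact huv.1.trans S.one_lt_A.le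
  have Q₀ := P₀ 1 one_pos le_rfl u hu u hu v hv (by simpa using hρ₀.le) huv.2.1 huv.2.1
  have Q₁ := P₁ 1 one_pos le_rfl u hu u hu v hv (by simpa using hρ₁.le) huv.2.2 huv.2.2
  simp only [hu₁, hv₁, div_one] at Q₀ Q₁
  rw [div_mul_eq_mul_div, div_mul_eq_mul_div, le_div_iff₀ hc₁, le_div_iff₀ hc₀]
  constructor
  · nlinarith
  · nlinarith

lemma IsTempered.continuous_distance (h : S.IsTempered) (hd : d ∈ S.distanceClass) :
    Continuous fun p : X × X => d p.1 p.2 := by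
  obtain ⟨m, M, -, H⟩ := h.locally_comparable hd
  refine hd.1.continuous_of_locally_le fun x => ?_
  obtain ⟨ρ, hρ, hρK⟩ := H _ (S.compact_closedBall x)
  refine ⟨min ρ 3, by positivity, M, fun u hu => (hρK u ?_ x (by simp) ?_).2⟩
  · exact hu.trans (min_le_right _ _)
  · exact hu.trans (min_le_left _ _)

lemma IsTempered.continuousOn_curve (h : S.IsTempered) (hd : d ∈ S.distanceClass) {γ : ℝ → X}
    {a b : ℝ} (hab : a ≤ b) (hγ : IsLipschitzCurveOn d γ (Icc a b)) : ContinuousOn γ (Icc a b) := by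
  have := S.complete
  obtain ⟨m, M, hm, H⟩ := h.locally_comparable hd
  obtain ⟨K, hK, hcover⟩ := h.exists_compact_cover (γ a)
  obtain ⟨L, hL0, hL⟩ := hγ.exists_nonneg
  -- Constant extension beyond `[a, b]` gives a curve Lipschitz on all of `ℝ`.
  have hc : Continuous (fun t => γ (projIcc a b hab t)) := by
    refine continuous_of_lipschitz_distance hd.1 (h.continuous_distance hd) hK hcover hm
      (fun n => ?_) (L := L) fun s t => ?_
    · obtain ⟨ρ, hρ, hρK⟩ := H _ (hK n)
      exact ⟨ρ, hρ, fun u hu v hv huv => (hρK u hu v hv huv).1⟩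
    · refine (hL _ (projIcc a b hab s).2 _ (projIcc a b hab t).2).trans ?_
      exact mul_le_mul_of_nonneg_left (abs_projIcc_sub_projIcc hab) hL0
  exact hc.continuousOn.congr fun t ht => by simp [projIcc_of_mem hab ht]

/-! ### Semicontinuity and approximation under convergence of distances. -/

section Convergence

variable {dn : ℕ → X → X → ℝ}

lemma tendsto_distance (h : S.IsTempered) (hd : d ∈ S.distanceClass)
    (hconv : ∀ K : Set (X × X), IsCompact K →
      TendstoUniformlyOn (fun n p => dn n p.1 p.2) (fun p => d p.1 p.2) atTop K)
    {u v : ℕ → X} {x y : X} (hu : Tendsto u atTop (𝓝 x)) (hv : Tendsto v atTop (𝓝 y)) :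
    Tendsto (fun n => dn n (u n) (v n)) atTop (𝓝 (d x y)) := by
  have hK := hconv _ ((S.compact_closedBall x).prod (S.compact_closedBall y))
  refine hK.tendsto_comp (x := (x, y)) (g := fun n => (u n, v n))
    (h.continuous_distance hd).continuousWithinAt ?_
  refine tendsto_nhdsWithin_iff.2 ⟨hu.prodMk_nhds hv, ?_⟩
  filter_upwards [hu.eventually (Metric.closedBall_mem_nhds x three_pos),
    hv.eventually (Metric.closedBall_mem_nhds y three_pos)] with n h₁ h₂ using ⟨h₁, h₂⟩

/-- Lower semicontinuity of lengths, when the distance varies too. -/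
lemma lengthOn_le_liminf {α : Type*} [LinearOrder α] (h : S.IsTempered) (hd : d ∈ S.distanceClass)
    (hconv : ∀ K : Set (X × X), IsCompact K →
      TendstoUniformlyOn (fun n p => dn n p.1 p.2) (fun p => d p.1 p.2) atTop K)
    {c : ℕ → α → X} {c₀ : α → X} {s : Set α}
    (hc : ∀ t ∈ s, Tendsto (fun n => c n t) atTop (𝓝 (c₀ t))) :
    lengthOn d c₀ s ≤ liminf (fun n => lengthOn (dn n) (c n) s) atTop := by
  refine iSup_le fun p => ?_
  have hlim : Tendsto (fun n => ∑ i ∈ Finset.range p.1,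
      ENNReal.ofReal (dn n (c n (p.2.1 i)) (c n (p.2.1 (i + 1))))) atTop
      (𝓝 (∑ i ∈ Finset.range p.1, ENNReal.ofReal (d (c₀ (p.2.1 i)) (c₀ (p.2.1 (i + 1)))))) :=
    tendsto_finsetSum _ fun i _ => ENNReal.tendsto_ofReal
      (tendsto_distance h hd hconv (hc _ (p.2.2.2 _)) (hc _ (p.2.2.2 _)))
  rw [← hlim.liminf_eq]
  exact liminf_le_liminf (Eventually.of_forall fun n =>
    sum_le_lengthOn (c n) p.2.2.1 p.2.2.2 p.1)

/-- Approximation of a curve by almost minimal polygons of nearby distances. -/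
lemma eventually_exists_approximation (h : S.IsTempered) (hdn : ∀ n, dn n ∈ S.distanceClass)
    (hd : d ∈ S.distanceClass)
    (hconv : ∀ K : Set (X × X), IsCompact K →
      TendstoUniformlyOn (fun n p => dn n p.1 p.2) (fun p => d p.1 p.2) atTop K)
    {c : C(unitInterval, X)} (hc : IsLipschitzCurveOn d c univ) {ε : ℝ} (hε : 0 < ε) :
    ∀ᶠ n in atTop, ∃ g : C(unitInterval, X), IsLipschitzCurveOn (dn n) g univ ∧ dist g c ≤ ε ∧
      lengthOn (dn n) g univ ≤ lengthOn d c univ + ENNReal.ofReal ε := by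
  obtain ⟨K, hK, hcK⟩ := S.exists_isCompact_of_dist_le_one (isCompact_range c.continuous)
  obtain ⟨r, hr, hrε, hr1⟩ : ∃ r > 0, r ≤ ε / 2 ∧ r ≤ 1 :=
    ⟨min (ε / 2) 1, by positivity, min_le_left _ _, min_le_right _ _⟩
  obtain ⟨θ, hθ, hθK⟩ := hK.exists_pos_le_distance hd.1 (h.continuous_distance hd) hr
  obtain ⟨Λ, hΛ, hcΛ⟩ := hc.exists_nonneg
  obtain ⟨δ, hδ, hcδ⟩ := Metric.uniformContinuous_iff.1
    (CompactSpace.uniformContinuous_of_continuous c.continuous) (ε / 2) (by positivity)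
  -- The mesh `1 / (k + 1)` keeps `c` within `ε / 2` on each piece and consecutive vertices within
  -- `d`-distance `θ / 4`.
  obtain ⟨k, hk⟩ := exists_nat_one_div_lt (show 0 < min δ (θ / (4 * (Λ + 1))) by positivity)
  rw [lt_min_iff, lt_div_iff₀ (by positivity)] at hk
  set m : ℝ := (k : ℝ) + 1 with hm
  have hm0 : 0 < m := by positivity
  -- Each of the `m` pieces spends `η` twice: in replacing `dn n` by `d`, and in being only almost
  -- minimal.
  obtain ⟨η, hη, hηθ, hηε⟩ : ∃ η > 0, η ≤ θ / 4 ∧ η ≤ ε / (2 * m) :=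
    ⟨min (θ / 4) (ε / (2 * m)), by positivity, min_le_left _ _, min_le_right _ _⟩
  set τ : ℕ → ℝ := fun i => i / m with hτ
  have hτmono : StrictMono τ := fun i j hij => div_lt_div_of_pos_right (by exact_mod_cast hij) hm0
  have hτ0 : τ 0 = 0 := by simp [hτ]
  have hτ1 : τ (k + 1) = 1 := by
    simp only [hτ, Nat.cast_add, Nat.cast_one]
    exact div_self hm0.ne'
  have hτstep : ∀ i, τ (i + 1) - τ i = 1 / m := by
    intro i
    simp only [hτ]
    push_cast
    ring
  set π : ℝ → unitInterval := projIcc 0 1 zero_le_one with hπ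
  have hπlip : ∀ s t, dist (π s) (π t) ≤ |s - t| := fun s t => abs_projIcc_sub_projIcc _
  have hpK : ∀ s, c (π s) ∈ K := fun s => hcK _ (mem_range_self (π s)) _ (by rw [dist_self]; exact zero_le_one)
  have hpd : ∀ i, d (c (π (τ i))) (c (π (τ (i + 1)))) < θ / 4 := by
    intro i
    have h₁ := hcΛ (π (τ i)) trivial (π (τ (i + 1))) trivial
    have h₂ := hπlip (τ i) (τ (i + 1))
    rw [abs_sub_comm, hτstep, abs_of_pos (by positivity)] at h₂
    have h₃ := mul_le_mul_of_nonneg_left h₂ hΛ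
    have h₄ : 0 < 1 / m := by positivity
    nlinarith
  filter_upwards [Metric.tendstoUniformlyOn_iff.1 (hconv _ (hK.prod hK)) η hη] with n hn
  have hclose : ∀ u ∈ K, ∀ v ∈ K, |d u v - dn n u v| < η := fun u hu v hv => hn (u, v) ⟨hu, hv⟩
  choose γ hγlip hγl hγr hγlen using fun i : ℕ =>
    (hdn n).2.1.exists_curve (hdn n).1 (c (π (τ i))) (c (π (τ (i + 1)))) hη
      (hτmono i.lt_succ_self)
  -- A piece has length below `θ / 4 + 2 * η ≤ 3 * θ / 4`, while the sphere of radius `r` is at `dn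
  -- n`-distance above `θ - η ≥ 3 * θ / 4`.
  have hnear : ∀ i, ∀ t ∈ Icc (τ i) (τ (i + 1)), dist (c (π (τ i))) (γ i t) ≤ r := by
    intro i t ht
    have hlt := (abs_lt.1 (hclose _ (hpK (τ i)) _ (hpK (τ (i + 1))))).1
    rw [← hγl i]
    refine dist_le_of_length_lt (hdn n).1
      (h.continuousOn_curve (hdn n) (hτmono i.lt_succ_self).le (hγlip i)) hr.le
      (add_nonneg ((hdn n).1.nonneg _ _) hη.le) (hγlen i) (fun z hz => ?_) t ht
    rw [hγl] at hz ⊢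
    have hzK : z ∈ K := hcK _ (mem_range_self (π (τ i))) z (hz.le.trans hr1)
    have h₁ := hθK _ (hpK (τ i)) z hzK hz.ge
    have h₂ := (abs_lt.1 (hclose _ (hpK (τ i)) z hzK)).2
    linarith [hpd i]
  obtain ⟨g, hglip, hgr, hglen, hg⟩ := exists_concatenation (hdn n).1 τ hτmono
    (fun i => c (π (τ i))) γ hγlip hγl hγr (k + 1)
  rw [hτ0, hτ1] at hglip hglen hg
  rw [hτ1] at hgr
  have hmaps : MapsTo (Subtype.val : unitInterval → ℝ) univ (Icc 0 1) := fun t _ => t.2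
  refine ⟨⟨g ∘ Subtype.val, ?_⟩, hglip.comp hmaps (κ := 1) fun p q => by rw [one_mul]; rfl,
    ?_, ?_⟩
  · exact continuousOn_iff_continuous_domRestrict.1 (h.continuousOn_curve (hdn n) zero_le_one hglip)
  · refine (ContinuousMap.dist_le hε.le).2 fun t => ?_
    change dist (g t) (c t) ≤ ε
    have hπt : π t = t := projIcc_val _ t
    rcases t.2.2.lt_or_eq with ht1 | ht1
    · obtain ⟨i, -, hti, hgt⟩ := hg t t.2 ht1
      have h₁ := hnear i t hti
      have h₂ : dist (π (τ i)) (π t) < δ := by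
        refine (hπlip _ _).trans_lt ?_
        rw [abs_sub_comm, abs_of_nonneg (sub_nonneg.2 hti.1)]
        linarith [hτstep i, hti.2]
      have h₃ := hcδ h₂
      rw [hπt] at h₃
      rw [hgt]
      linarith [dist_triangle_left (γ i t) (c t) (c (π (τ i)))]
    · have h₁ : g t = c t := by rw [ht1, hgr, ← ht1, hπt]
      rw [h₁, dist_self]
      exact hε.le
  · have hle : ∀ i, lengthOn (dn n) (γ i) (Icc (τ i) (τ (i + 1))) ≤
        ENNReal.ofReal (d (c (π (τ i))) (c (π (τ (i + 1))))) + ENNReal.ofReal (ε / m) := by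
      intro i
      rw [← ENNReal.ofReal_add (hd.1.nonneg _ _) (by positivity)]
      refine (hγlen i).trans (ENNReal.ofReal_le_ofReal ?_)
      have h₁ := (abs_lt.1 (hclose _ (hpK (τ i)) _ (hpK (τ (i + 1))))).1
      have h₂ : ε / m = ε / (2 * m) + ε / (2 * m) := by field_simp; norm_num
      linarith
    calc lengthOn (dn n) (g ∘ Subtype.val) univ
        ≤ lengthOn (dn n) g (Icc 0 1) := lengthOn_comp_le g (Subtype.mono_coe _) hmaps
      _ ≤ ∑ i ∈ Finset.range (k + 1), (ENNReal.ofReal (d (c (π (τ i))) (c (π (τ (i + 1))))) +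
            ENNReal.ofReal (ε / m)) := by
          rw [hglen]
          exact Finset.sum_le_sum fun i _ => hle i
      _ ≤ lengthOn d c univ + ENNReal.ofReal ε := by
          rw [Finset.sum_add_distrib]
          refine add_le_add (sum_le_lengthOn c (t := fun i => π (τ i))
            ((monotone_projIcc _).comp hτmono.monotone) (fun _ => mem_univ _) (k + 1)) (le_of_eq ?_)
          rw [Finset.sum_const, Finset.card_range, ← ENNReal.ofReal_nsmul, nsmul_eq_mul]
          congr 1
          push_cast
          exact mul_div_cancel₀ _ hm0.ne'

end Convergence

end DilatationStructure

/-! ### Gamma-convergence. -/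

theorem theorem8p3 {Ω : Type*} [MetricSpace Ω] (S : DilatationStructure Ω)
    (hstrong : S.IsStrong) (htempered : S.IsTempered) (hRN : S.RadonNikodym)
    (dn : ℕ → Ω → Ω → ℝ) (d : Ω → Ω → ℝ)
    (hdn : ∀ n, dn n ∈ S.distanceClass) (hd : d ∈ S.distanceClass)
    (hconv : ∀ K : Set (Ω × Ω), IsCompact K →
      TendstoUniformlyOn (fun n p => dn n p.1 p.2) (fun p => d p.1 p.2) atTop K) :
    GammaConverges (Y := C(unitInterval, Ω))
      (fun n => {c | IsLipschitzCurveOn (dn n) c univ}) (fun n c => lengthOn (dn n) c univ)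
      {c | IsLipschitzCurveOn d c univ} (fun c => lengthOn d c univ) := by
  have hlower : ∀ c₀ : C(unitInterval, Ω), ∀ c : ℕ → C(unitInterval, Ω),
      Tendsto c atTop (𝓝 c₀) →
      lengthOn d c₀ univ ≤ liminf (fun n => lengthOn (dn n) (c n) univ) atTop :=
    fun c₀ c hc => DilatationStructure.lengthOn_le_liminf htempered hd hconv fun t _ =>
      ((continuous_eval_const (F := C(unitInterval, Ω)) t).tendsto c₀).comp hc
  refine ⟨fun c₀ _ c _ hc => hlower c₀ c hc, fun c₀ hc₀ => ?_⟩
  obtain ⟨c, hcZ, hc⟩ := exists_seq_of_forall_eventually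
    (Z := fun n => {c : C(unitInterval, Ω) | IsLipschitzCurveOn (dn n) c univ})
    (P := fun n k c => dist c c₀ ≤ 1 / ((k : ℝ) + 1) ∧
      lengthOn (dn n) c univ ≤ lengthOn d c₀ univ + ENNReal.ofReal (1 / ((k : ℝ) + 1)))
    (fun n => ⟨ContinuousMap.const _ (c₀ 0), isLipschitzCurveOn_const (hdn n).1 _ _⟩)
    (fun n c k l hkl hP => by
      have hle := Nat.one_div_le_one_div (α := ℝ) hkl
      exact ⟨hP.1.trans hle, hP.2.trans (add_le_add le_rfl (ENNReal.ofReal_le_ofReal hle))⟩)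
    (fun k => DilatationStructure.eventually_exists_approximation htempered hdn hd hconv hc₀
      Nat.one_div_pos_of_nat)
  have hlim : Tendsto c atTop (𝓝 c₀) := by
    refine Metric.tendsto_atTop'.2 fun ε hε => ?_
    obtain ⟨k, hk⟩ := exists_nat_one_div_lt hε
    obtain ⟨N, hN⟩ := eventually_atTop.1 (hc k)
    exact ⟨N, fun n hn => (hN n hn.le).1.trans_lt hk⟩
  -- The lower bound applied to the recovery sequence itself leaves only the limsup estimate.
  refine ⟨c, hcZ, hlim, tendsto_of_le_liminf_of_limsup_le (hlower c₀ c hlim) ?_⟩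
  refine ENNReal.le_of_forall_pos_le_add fun ε hε _ => ?_
  obtain ⟨k, hk⟩ := exists_nat_one_div_lt (NNReal.coe_pos.2 hε)
  refine limsup_le_of_le (by isBoundedDefault) ?_
  filter_upwards [hc k] with n hn
  refine hn.2.trans (add_le_add le_rfl ?_)
  rw [← ENNReal.ofReal_coe_nnreal]
  exact ENNReal.ofReal_le_ofReal hk.le
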